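/- Let $n\ge 0$, $N\ge 1$, $[N]=\{1,\dots,N\}$. For $i\in[N]$ let $h_i:\mathbb R^n\to\mathbb R$ be a Legendre kernel with full domain, i.e. strictly convex, $C^1$ and $1$-coercive ($h_i(x)/\|x\|\to\infty$ as $\|x\|\to\infty$), and suppose that $\nabla h_i$ is $\ell_{h_i}$-Lipschitz on $\mathbb R^n$. Let $f_i:\mathbb R^n\to\mathbb R$ be $L_{f_i}$-smooth relative to $h_i$ with $L_{f_i}>0$, i.e. $L_{f_i}h_i+f_i$ and $L_{f_i}h_i-f_i$ are convex (the individual $f_i$ may be nonconvex); then $\nabla f_i$ is Lipschitz with modulus $\ell_{f_i}:=L_{f_i}\ell_{h_i}$. Let $g:\mathbb R^n\to\mathbb R\cup\{\infty\}$ be proper, lower semicontinuous and convex, let $f:=\frac1N\sum_{i=1}^N f_i$ be $\mu_f$-strongly convex with $\mu_f>0$, set $\varphi:=f+g$, and suppose that $\varphi$ has a minimizer $x^\star$; put $\varphi_\star:=\varphi(x^\star)$. Let $\alpha\in(0,1)$, $\gamma_i:=\alpha N/L_{f_i}$ and $\hat h_i:=\frac1{\gamma_i}h_i-\frac1N f_i$,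 and let $\hat h_i^*$ be the convex conjugate of $\hat h_i$. For differentiable $\psi$ let $D_\psi(x,y):=\psi(x)-\psi(y)-\langle\nabla\psi(y),x-y\rangle$, and let $$\mathcal L(z,s):=\varphi(z)+\sum_{i=1}^N D_{\hat h_i^*}\bigl(s_i,\nabla\hat h_i(z)\bigr),\qquad z\in\mathbb R^n,\ s=(s_1,\dots,s_N)\in(\mathbb R^n)^N .$$ Consider the Bregman Finito/MISO algorithm: given $x^{\rm init}\in\mathbb R^n$, start from $s_i^0=\frac1{\gamma_i}\nabla h_i(x^{\rm init})-\frac1N\nabla f_i(x^{\rm init})$ and $\tilde s^0=\sum_i s_i^0$, and for $k=0,1,2,\dots$ take $$z^k\in\operatorname*{argmin}_{w\in\mathbb R^n}\Bigl\{g(w)+\sum_{i=1}^N\tfrac1{\gamma_i}h_i(w)-\langle\tilde s^k,w\rangle\Bigr\},$$ select a random set $\mathcal I^{k+1}\subseteq[N]$, put $s_i^{k+1}=\frac1{\gamma_i}\nabla h_i(z^k)-\frac1N\nabla f_i(z^k)$ for $i\in\mathcal I^{k+1}$, $s_i^{k+1}=s_i^k$ for $i\notin\mathcal I^{k+1}$,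 and $\tilde s^{k+1}=\tilde s^k+\sum_{i\in\mathcal I^{k+1}}(s_i^{k+1}-s_i^k)$. The sampling is randomized: there are a filtration $(\mathcal F_k)_{k\ge0}$ such that $\mathcal I^{k+1}$ is $\mathcal F_{k+1}$-measurable, and numbers $p_1,\dots,p_N>0$, such that $\mathbb P(i\in\mathcal I^{k+1}\mid\mathcal F_k)=p_i$ almost surely for all $k\in\mathbb N$ and $i\in[N]$. Put $$\kappa_f:=\frac{\frac1N\sum_{i=1}^N\ell_{f_i}}{\mu_f},\qquad c:=\frac{\alpha\,\min_i p_i}{\kappa_f}$$ (with $c:=0$ if $\kappa_f=0$, which can happen only for $n=0$). Then $\varphi$ is $\mu_f$-strongly convex, $\varphi_\star$ and all $\varphi(z^k)$ are finite, the random variables $\mathcal L(z^k,s^k)$, $\varphi(z^k)$ and $\|z^k-x^\star\|^2$ are integrable, and the linear-rate bounds hold with this $c$: for every $k\in\mathbb N$, $$\mathbb E\bigl[\mathcal L(z^{k+1},s^{k+1})-\varphi_\star\mid\mathcal F_k\bigr]\le(1-c)\bigl(\mathcal L(z^k,s^k)-\varphi_\star\bigr)\quad\text{almost surely},$$ and,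 for every $\mu_\varphi>0$ such that $\varphi$ is $\mu_\varphi$-strongly convex (in particular for $\mu_\varphi=\mu_f$), $$\mathbb E\bigl[\tfrac{\mu_\varphi}2\|z^k-x^\star\|^2\bigr]\le\mathbb E\bigl[\varphi(z^k)-\varphi_\star\bigr]\le(1-c)^k\bigl(\varphi(x^{\rm init})-\varphi_\star\bigr),$$ where the right-hand side may be $+\infty$. -/

import Mathlib

open MeasureTheory ProbabilityTheory Filter Topology
open scoped NNReal

noncomputable section

namespace BFinito

/-- `ℝⁿ` with its Euclidean norm. -/
abbrev Vec (n : ℕ) : Type := EuclideanSpace ℝ (Fin n)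

variable {n N : ℕ}

/-- The set of global minimizers of an extended-real-valued function. -/
def argmin (F : Vec n → EReal) : Set (Vec n) := {w | ∀ v, F w ≤ F v}

/-- Convexity of an extended-real-valued function: its epigraph is convex. -/
def ExtConvex (F : Vec n → EReal) : Prop :=
  Convex ℝ {q : Vec n × ℝ | F q.1 ≤ (q.2 : EReal)}

/-- `μ`-strong convexity of an extended-real-valued function: `F - (μ/2)‖·‖²` is convex. -/
def ExtStronglyConvex (μ : ℝ) (F : Vec n → EReal) : Prop :=
  ExtConvex fun x => F x + ((-(μ / 2 * ‖x‖ ^ 2) : ℝ) : EReal)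

/-- Proper function with values in `ℝ ∪ {+∞}`. -/
def ExtProper (F : Vec n → EReal) : Prop :=
  (∀ x, F x ≠ ⊥) ∧ ∃ x, F x ≠ ⊤

/-- Legendre kernel whose domain is the whole space: strictly convex, continuously
differentiable and `1`-coercive.  (Properness and lower semicontinuity are then automatic, and
essential smoothness is void because the domain has no boundary points.) -/
structure IsLegendreKernel (h : Vec n → ℝ) : Prop where
  strictConvex : StrictConvexOn ℝ Set.univ h
  contDiff : ContDiff ℝ 1 h
  coercive : Tendsto (fun x => h x / ‖x‖) (Bornology.cobounded (Vec n)) atTop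

/-- `f` is `L`-smooth relative to the full-domain kernel `h`. -/
structure IsRelSmooth (L : ℝ) (f h : Vec n → ℝ) : Prop where
  nonneg : 0 ≤ L
  convex_add : ConvexOn ℝ Set.univ fun x => L * h x + f x
  convex_sub : ConvexOn ℝ Set.univ fun x => L * h x - f x

/-- Bregman distance `D_h(x, y) = h(x) - h(y) - ⟨∇h(y), x - y⟩` of a function that is
differentiable on the whole space. -/
def bregman (h : Vec n → ℝ) (x y : Vec n) : ℝ :=
  h x - h y - inner ℝ (gradient h y) (x - y)

/-- Convex conjugate `h*(y) = sup_x (⟨y, x⟩ - h(x))`.  The supremum is finite for every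
`1`-coercive continuous `h`, the only case in which it is used. -/
def conjugate (h : Vec n → ℝ) (y : Vec n) : ℝ := ⨆ x, (inner ℝ y x - h x)

/-- The average `f = (1/N) ∑ᵢ fᵢ`. -/
def average (f : Fin N → Vec n → ℝ) (x : Vec n) : ℝ := 1 / (N : ℝ) * ∑ i, f i x

/-- The cost `φ = (1/N) ∑ᵢ fᵢ + g`. -/
def cost (f : Fin N → Vec n → ℝ) (g : Vec n → EReal) (x : Vec n) : EReal :=
  ((average f x : ℝ) : EReal) + g x

/-- The functions `ĥᵢ = hᵢ / γᵢ - fᵢ / N`. -/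
def hHat (f h : Fin N → Vec n → ℝ) (γ : Fin N → ℝ) (i : Fin N) (x : Vec n) : ℝ :=
  1 / γ i * h i x - 1 / (N : ℝ) * f i x

/-- The Lyapunov function `𝓛(z, s) = φ(z) + ∑ᵢ D_{ĥᵢ*}(sᵢ, ∇ĥᵢ(z))`. -/
def lyapunov (f h : Fin N → Vec n → ℝ) (g : Vec n → EReal) (γ : Fin N → ℝ)
    (z : Vec n) (s : Fin N → Vec n) : EReal :=
  cost f g z +
    ((∑ i, bregman (conjugate (hHat f h γ i)) (s i) (gradient (hHat f h γ i) z) : ℝ) : EReal)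

/-- The inner minimization `T(s) = argmin_w { g(w) + ∑ᵢ hᵢ(w)/γᵢ - ⟨s, w⟩ }`. -/
def innerProx (h : Fin N → Vec n → ℝ) (g : Vec n → EReal) (γ : Fin N → ℝ)
    (s : Vec n) : Set (Vec n) :=
  argmin fun w => g w + ((∑ i, 1 / γ i * h i w - inner ℝ s w : ℝ) : EReal)

/-- The sequences `(s k, sTilde k, z k)` are generated by the Bregman Finito/MISO algorithm from
`xinit`, with `I (k + 1)` the set of indices that is selected at iteration `k`. -/
structure IsBFinito (f h : Fin N → Vec n → ℝ) (g : Vec n → EReal) (γ : Fin N → ℝ)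
    (xinit : Vec n) (I : ℕ → Finset (Fin N))
    (s : ℕ → Fin N → Vec n) (sTilde z : ℕ → Vec n) : Prop where
  s_zero : ∀ i, s 0 i = (1 / γ i) • gradient (h i) xinit - (1 / (N : ℝ)) • gradient (f i) xinit
  sTilde_zero : sTilde 0 = ∑ i, s 0 i
  z_mem : ∀ k, z k ∈ innerProx h g γ (sTilde k)
  s_succ : ∀ k i, s (k + 1) i =
    if i ∈ I (k + 1) then
      (1 / γ i) • gradient (h i) (z k) - (1 / (N : ℝ)) • gradient (f i) (z k)
    else s k i
  sTilde_succ : ∀ k, sTilde (k + 1) = sTilde k + ∑ i ∈ I (k + 1), (s (k + 1) i - s k i)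

/-- Randomized sampling rule: conditionally on the information `ℱ k` available at iteration `k`
(which contains the sets selected before), index `i` belongs to the random set `I (k + 1)` with
probability `p i > 0`. -/
structure IsRandomizedSampling {Ω : Type*} {mΩ : MeasurableSpace Ω} (P : Measure Ω)
    (ℱ : Filtration ℕ mΩ) (p : Fin N → ℝ) (I : ℕ → Ω → Finset (Fin N)) : Prop where
  pos : ∀ i, 0 < p i
  measurableSet : ∀ k i, MeasurableSet[ℱ (k + 1)] {ω | i ∈ I (k + 1) ω}
  condProb : ∀ k i,
    P[{ω | i ∈ I (k + 1) ω}.indicator (fun _ => (1 : ℝ)) | ℱ k] =ᵐ[P] fun _ => p i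

/-- The basic requirements on the problem, for kernels with full domain. -/
structure BasicAssumption (f h : Fin N → Vec n → ℝ) (g : Vec n → EReal) (L : Fin N → ℝ) :
    Prop where
  legendre : ∀ i, IsLegendreKernel (h i)
  relSmooth : ∀ i, IsRelSmooth (L i) (f i) (h i)
  proper : ExtProper g
  lsc : LowerSemicontinuous g
  solution : (argmin (cost f g)).Nonempty

/-- `min_i p_i`. -/
def minProb [NeZero N] (p : Fin N → ℝ) : ℝ := Finset.univ.inf' Finset.univ_nonempty p

/-- `κ_f = ((1/N) ∑ᵢ ℓ_{fᵢ}) / μ_f`, where `ℓ_{fᵢ} = L_{fᵢ} ℓ_{hᵢ}` is the Lipschitz modulus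
that `∇fᵢ` inherits from the Lipschitz modulus `ℓ_{hᵢ}` of `∇hᵢ`. -/
def condNumber (L : Fin N → ℝ) (ℓh : Fin N → ℝ≥0) (μf : ℝ) : ℝ :=
  (1 / (N : ℝ) * ∑ i, L i * (ℓh i : ℝ)) / μf

end BFinito

end

/-!
Let `G(s, z) = ∑ᵢ D_{ĥᵢ*}(sᵢ, ∇ĥᵢ(z))`, so that `𝓛(z, s) = φ(z) + G(s, z)`. The vectors `sᵢ`
always lie in the range of `∇ĥᵢ`. There `D_{ĥᵢ*}(sᵢ, ∇ĥᵢ(z))` equals the Fenchel-Young gap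
`ĥᵢ(z) - ⟨sᵢ, z⟩ + ĥᵢ*(sᵢ)` (`bregman_conjugate_eq_gap`), because `ĥᵢ` is strictly convex and
differentiable and `∇ĥᵢ*` inverts `∇ĥᵢ` (`hasGradientAt_conjugate`). As a consequence the inner
minimization is the minimization of `w ↦ 𝓛(w, s)`.

*Decrease.* Comparing the new minimizer with the old point `zᵏ`, at which the updated gaps vanish,
gives `𝓛(zᵏ⁺¹, sᵏ⁺¹) ≤ 𝓛(zᵏ, sᵏ) - ∑_{i ∈ Iᵏ⁺¹} D_{ĥᵢ*}(sᵢᵏ, ∇ĥᵢ(zᵏ))`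
(`IsBFinito.lyapunov_succ_le`). In conditional expectation the subtracted term is at least
`min p · G(sᵏ, zᵏ)`.

*Error bound.* It remains to see that `α (𝓛(z, s) - φ⋆) ≤ κ_f G(s, z)` (`Standing.lyapunov_sub_le`).
Write `S = ∑ᵢ (∇ĥᵢ(z) - sᵢ)` and `A = (κ_f/α - 1) μ_f`. Since `∑ᵢ ĥᵢ = ∑ᵢ hᵢ/γᵢ - f` and `f` is
strongly convex, `∑ᵢ ĥᵢ` is smooth with modulus `A` (`Standing.sum_bregman_hHat_le`), although the
individual `ĥᵢ` need not have moduli that add up to `A`. All gaps are nonnegative, hence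
`0 ≤ G(s, z + d) ≤ G(s, z) + ⟨S, d⟩ + (A/2)‖d‖²` for every `d`, and `d = -S/A` yields
`‖S‖² ≤ 2 A G(s, z)`. As `-S` is a subgradient of the strongly convex `φ` at `z`, also
`φ(z) - φ⋆ ≤ ‖S‖²/(2μ_f) ≤ (κ_f/α - 1) G(s, z)`; adding `G(s, z)` gives the bound.

*Measurability.* The inner problem has a unique solution, so the iterates at time `k` are functions
of the first `k` selected index sets (`IsBFinito.congr_history`). They take finitely many values and
are measurable with respect to `ℱ k`.
-/

namespace BFinito

/-! ### Convex functions, gradients and Bregman distances -/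

/-- A finite convex function has a subgradient at every point: its strict epigraph is open and
convex, and can be separated from the point of the graph. -/
lemma exists_subgradient {n : ℕ} {u : Vec n → ℝ} (hu : ConvexOn ℝ Set.univ u) (x : Vec n) :
    ∃ p : Vec n, ∀ y, u x + inner ℝ p (y - x) ≤ u y := by
  have hcont : Continuous u := continuousOn_univ.1 (hu.continuousOn isOpen_univ)
  have hconv : Convex ℝ {q : Vec n × ℝ | u q.1 < q.2} := by
    simpa using hu.convex_strict_epigraph
  have hopen : IsOpen {q : Vec n × ℝ | u q.1 < q.2} :=
    isOpen_lt (hcont.comp continuous_fst) continuous_snd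
  obtain ⟨F, hF⟩ := geometric_hahn_banach_open_point (x := (x, u x)) hconv hopen (by simp)
  have hsplit : ∀ (y : Vec n) (r : ℝ), F (y, r) = F (y, 0) + r * F (0, 1) := by
    intro y r
    have : ((y, r) : Vec n × ℝ) = (y, 0) + r • (0, 1) := by simp
    rw [this, map_add, map_smul, smul_eq_mul]
  have hb : F (0, 1) < 0 := by
    have := hF (x, u x + 1) (by simp)
    rw [hsplit, hsplit x (u x)] at this
    linarith
  set b := -F (0, 1) with hbdef
  have hbpos : 0 < b := by linarith
  let G : Vec n →L[ℝ] ℝ := F.comp (ContinuousLinearMap.inl ℝ (Vec n) ℝ)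
  refine ⟨b⁻¹ • (InnerProductSpace.toDual ℝ (Vec n)).symm G, fun y => ?_⟩
  rw [inner_smul_left, InnerProductSpace.toDual_symm_apply, map_sub]
  have hG : ∀ v, G v = F (v, 0) := fun v => rfl
  refine le_of_forall_pos_le_add fun ε hε => ?_
  have := hF (y, u y + ε) (by simpa using hε)
  rw [hsplit, hsplit x (u x), ← hG, ← hG] at this
  have h2 : b⁻¹ * (G y - G x) < u y + ε - u x := by
    rw [inv_mul_lt_iff₀ hbpos]
    have : F (0, 1) = -b := by simp [hbdef]
    rw [this] at *
    linarith
  simp only [conj_trivial]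
  linarith

/-- The gradient is the only subgradient at a point of differentiability. -/
lemma gradient_eq_of_subgradient {n : ℕ} {u : Vec n → ℝ} {x p : Vec n}
    (hd : DifferentiableAt ℝ u x) (hp : ∀ y, u x + inner ℝ p (y - x) ≤ u y) :
    gradient u x = p := by
  have hmin : IsLocalMin (fun y => u y - inner ℝ p y) x := by
    refine Eventually.of_forall fun y => ?_
    have := hp y
    rw [inner_sub_right] at this
    linarith
  have hder : HasFDerivAt (fun y => u y - inner ℝ p y) (fderiv ℝ u x - innerSL ℝ p) x :=
    hd.hasFDerivAt.sub (innerSL ℝ p).hasFDerivAt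
  have h0 := hmin.hasFDerivAt_eq_zero hder
  refine ext_inner_right ℝ fun v => ?_
  rw [inner_gradient_left]
  have := congrArg (fun T => T v) h0
  simp only [sub_apply, zero_apply,
    innerSL_apply_apply] at this
  linarith

/-- If the sum of two finite convex functions is differentiable, so is each of them: subgradients
of the two summands add up to the gradient of the sum, so that the two nonnegative
linearization errors have a sum of smaller order. -/
lemma differentiableAt_left_of_add {n : ℕ} {u v : Vec n → ℝ} (hu : ConvexOn ℝ Set.univ u)
    (hv : ConvexOn ℝ Set.univ v) {x : Vec n} (h : DifferentiableAt ℝ (fun y => u y + v y) x) :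
    DifferentiableAt ℝ u x := by
  obtain ⟨p, hp⟩ := exists_subgradient hu x
  obtain ⟨q, hq⟩ := exists_subgradient hv x
  have hpq : gradient (fun y => u y + v y) x = p + q := by
    refine gradient_eq_of_subgradient h fun y => ?_
    rw [inner_add_left]
    linarith [hp y, hq y]
  have hg := h.hasGradientAt
  rw [hpq, hasGradientAt_iff_isLittleO] at hg
  have : HasGradientAt u p x := by
    rw [hasGradientAt_iff_isLittleO]
    refine Asymptotics.IsBigO.trans_isLittleO (Asymptotics.IsBigO.of_bound 1 ?_) hg
    refine Eventually.of_forall fun y => ?_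
    have h1 := hp y
    have h2 := hq y
    rw [one_mul, inner_add_left, Real.norm_of_nonneg (by linarith),
      Real.norm_of_nonneg (by linarith)]
    linarith
  exact this.differentiableAt

lemma bregman_eq_fderiv {n : ℕ} (u : Vec n → ℝ) (x y : Vec n) :
    bregman u x y = u x - u y - fderiv ℝ u y (x - y) := by
  rw [bregman, inner_gradient_left]

@[simp] lemma bregman_self {n : ℕ} (u : Vec n → ℝ) (x : Vec n) : bregman u x x = 0 := by
  simp [bregman]

/-- Bregman distances of convex functions are nonnegative. -/
lemma bregman_nonneg {n : ℕ} {u : Vec n → ℝ} (hu : ConvexOn ℝ Set.univ u)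
    (hd : Differentiable ℝ u) (x y : Vec n) : 0 ≤ bregman u x y := by
  obtain ⟨p, hp⟩ := exists_subgradient hu y
  rw [bregman, gradient_eq_of_subgradient (hd y) hp]
  linarith [hp x]

/-- `D_u(·, y)` is convex along rays that start in `y`. -/
lemma bregman_lineMap_le {n : ℕ} {u : Vec n → ℝ} (hu : ConvexOn ℝ Set.univ u) (x y : Vec n)
    {t : ℝ} (h0 : 0 ≤ t) (h1 : t ≤ 1) : bregman u (y + t • (x - y)) y ≤ t * bregman u x y := by
  have hc := hu.2 (Set.mem_univ x) (Set.mem_univ y) h0 (sub_nonneg.2 h1) (by ring)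
  have : t • x + (1 - t) • y = y + t • (x - y) := by module
  rw [this, smul_eq_mul, smul_eq_mul] at hc
  simp only [bregman, add_sub_cancel_left, inner_smul_right]
  linarith

lemma bregman_pos {n : ℕ} {u : Vec n → ℝ} (hu : StrictConvexOn ℝ Set.univ u)
    (hd : Differentiable ℝ u) {x y : Vec n} (hxy : x ≠ y) : 0 < bregman u x y := by
  have hhalf : (0 : ℝ) < 1 / 2 := by norm_num
  have hc := hu.2 (Set.mem_univ x) (Set.mem_univ y) hxy hhalf hhalf (by norm_num)
  have h := bregman_nonneg hu.convexOn hd (((1 : ℝ) / 2) • x + ((1 : ℝ) / 2) • y) y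
  have : ((1 : ℝ) / 2) • x + ((1 : ℝ) / 2) • y - y = ((1 : ℝ) / 2) • (x - y) := by module
  simp only [bregman, this, inner_smul_right, smul_eq_mul] at h hc ⊢
  linarith

/-- Descent lemma. -/
lemma bregman_le_of_lipschitz {n : ℕ} {u : Vec n → ℝ} (hd : Differentiable ℝ u) {ℓ : ℝ≥0}
    (hl : LipschitzWith ℓ (gradient u)) (x y : Vec n) :
    bregman u x y ≤ ℓ / 2 * ‖x - y‖ ^ 2 := by
  let F : ℝ → ℝ := fun t => u (y + t • (x - y)) - t * inner ℝ (gradient u y) (x - y)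
    - t ^ 2 * (ℓ / 2 * ‖x - y‖ ^ 2)
  have hF : ∀ t, HasDerivAt F (inner ℝ (gradient u (y + t • (x - y))) (x - y)
      - 1 * inner ℝ (gradient u y) (x - y) - (2 * t) * (ℓ / 2 * ‖x - y‖ ^ 2)) t := by
    intro t
    have h1 : HasDerivAt (fun t : ℝ => y + t • (x - y)) (x - y) t := by
      simpa using ((hasDerivAt_id t).smul_const (x - y)).const_add y
    have h2 := (hd (y + t • (x - y))).hasFDerivAt.comp_hasDerivAt t h1
    rw [← inner_gradient_left] at h2
    have h3 : HasDerivAt (fun t : ℝ => t ^ 2) (2 * t) t := by simpa using hasDerivAt_pow 2 t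
    exact (h2.sub ((hasDerivAt_id t).mul_const _)).sub (h3.mul_const _)
  have hanti : AntitoneOn F (Set.Icc 0 1) := by
    refine antitoneOn_of_deriv_nonpos (convex_Icc 0 1)
      (fun t _ => (hF t).continuousAt.continuousWithinAt)
      (fun t _ => (hF t).differentiableAt.differentiableWithinAt) fun t ht => ?_
    rw [interior_Icc] at ht
    rw [(hF t).deriv, one_mul, ← inner_sub_left]
    have h1 := real_inner_le_norm (gradient u (y + t • (x - y)) - gradient u y) (x - y)
    have h2 := hl.dist_le_mul (y + t • (x - y)) y
    rw [dist_eq_norm, dist_eq_norm, add_sub_cancel_left, norm_smul,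
      Real.norm_of_nonneg ht.1.le] at h2
    have h3 := mul_le_mul_of_nonneg_right h2 (norm_nonneg (x - y))
    nlinarith
  have := hanti (by simp) (by simp) (zero_le_one' ℝ)
  simp only [F, zero_smul, one_smul, add_sub_cancel, add_zero, zero_mul, one_mul, sub_zero,
    one_pow, ne_eq, OfNat.ofNat_ne_zero, not_false_eq_true, zero_pow] at this
  rw [bregman]
  linarith

/-- The Bregman distance of a strongly convex function dominates the squared distance. -/
lemma le_bregman_of_strongConvexOn {n : ℕ} {u : Vec n → ℝ} {μ : ℝ}
    (hu : StrongConvexOn Set.univ μ u) (hd : Differentiable ℝ u) (x y : Vec n) :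
    μ / 2 * ‖x - y‖ ^ 2 ≤ bregman u x y := by
  have hq : HasFDerivAt (fun w : Vec n => μ / 2 * ‖w‖ ^ 2) ((μ / 2) • (2 • innerSL ℝ y)) y :=
    ((hasStrictFDerivAt_norm_sq y).hasFDerivAt).const_mul (μ / 2)
  have h := bregman_nonneg (strongConvexOn_iff_convex.1 hu)
    (hd.sub ((contDiff_norm_sq ℝ (n := 1)).differentiable (by simp) |>.const_mul _)) x y
  rw [bregman_eq_fderiv] at h ⊢
  have h2 := ((hd y).hasFDerivAt.sub hq).fderiv
  have h3 : fderiv ℝ (fun x => u x - μ / 2 * ‖x‖ ^ 2) y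
    = fderiv ℝ u y - (μ / 2) • (2 • innerSL ℝ y) := h2
  rw [h3] at h
  simp only [sub_apply, smul_apply, innerSL_apply_apply,
    smul_eq_mul, nsmul_eq_mul, inner_sub_right, real_inner_self_eq_norm_sq] at h
  rw [norm_sub_sq_real, real_inner_comm]
  push_cast at h
  linarith

/-! ### Duality of Bregman distances -/

/-- The estimate behind the differentiability of the conjugate: a strictly convex function grows at
least linearly away from its tangent hyperplane at `z`. -/
lemma exists_linear_growth {n : ℕ} {u : Vec n → ℝ} (hu : StrictConvexOn ℝ Set.univ u)
    (hd : Differentiable ℝ u) (z : Vec n) {ε : ℝ} (hε : 0 < ε) :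
    ∃ δ > 0, ∀ x, ε ≤ ‖x - z‖ → δ * ‖x - z‖ ≤ bregman u x z := by
  have hcont : Continuous fun x => bregman u x z := by
    unfold bregman
    have := hd.continuous
    fun_prop
  obtain ⟨m, hm, hmle⟩ : ∃ m > 0, ∀ x ∈ Metric.sphere z ε, m ≤ bregman u x z := by
    rcases (Metric.sphere z ε).eq_empty_or_nonempty with he | hne
    · exact ⟨1, one_pos, by simp [he]⟩
    · obtain ⟨x, hx, hmin⟩ := (isCompact_sphere z ε).exists_isMinOn hne hcont.continuousOn
      refine ⟨_, bregman_pos hu hd (x := x) (y := z) ?_, fun y hy => hmin hy⟩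
      rintro rfl
      simp at hx
      exact hε.ne hx
  refine ⟨m / ε, by positivity, fun x hx => ?_⟩
  have hpos : 0 < ‖x - z‖ := hε.trans_le hx
  have h1 := bregman_lineMap_le hu.convexOn x z (t := ε / ‖x - z‖) (by positivity)
    ((div_le_one hpos).2 hx)
  have h2 := hmle (z + (ε / ‖x - z‖) • (x - z)) (by
    rw [mem_sphere_iff_norm, add_sub_cancel_left, norm_smul, Real.norm_of_nonneg (by positivity)]
    field_simp)
  have h3 := h2.trans h1
  rw [div_mul_eq_mul_div, le_div_iff₀ hpos] at h3
  rw [div_mul_eq_mul_div, div_le_iff₀ hε]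
  linarith

/-- Equality in the Fenchel-Young inequality. -/
lemma conjugate_gradient {n : ℕ} {u : Vec n → ℝ} (hu : ConvexOn ℝ Set.univ u)
    (hd : Differentiable ℝ u) (z : Vec n) :
    conjugate u (gradient u z) = inner ℝ (gradient u z) z - u z := by
  have hle : ∀ x, inner ℝ (gradient u z) x - u x ≤ inner ℝ (gradient u z) z - u z := by
    intro x
    have := bregman_nonneg hu hd x z
    rw [bregman, inner_sub_right] at this
    linarith
  exact le_antisymm (ciSup_le hle) (le_ciSup ⟨_, Set.forall_mem_range.2 hle⟩ z)

/-- The gradient of the conjugate inverts the gradient. Near `∇u(z)` the supremum that defines the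
conjugate is finite, and its value is squeezed between the affine function
`v ↦ ⟨v, z⟩ - u(z)` and the same function plus an error of smaller order. -/
lemma hasGradientAt_conjugate {n : ℕ} {u : Vec n → ℝ} (hu : StrictConvexOn ℝ Set.univ u)
    (hd : Differentiable ℝ u) (z : Vec n) :
    HasGradientAt (conjugate u) z (gradient u z) := by
  rw [hasGradientAt_iff_isLittleO, Asymptotics.isLittleO_iff]
  intro ε hε
  obtain ⟨δ, hδ, hgrow⟩ := exists_linear_growth hu hd z hε
  filter_upwards [Metric.ball_mem_nhds (gradient u z) hδ] with v hv
  rw [mem_ball_iff_norm] at hv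
  have hle : ∀ x, inner ℝ v x - u x ≤ inner ℝ v z - u z + ε * ‖v - gradient u z‖ := by
    intro x
    have hb : inner ℝ v x - u x = inner ℝ v z - u z + inner ℝ (v - gradient u z) (x - z)
        - bregman u x z := by
      simp only [bregman, inner_sub_left, inner_sub_right]
      ring
    have hcs := real_inner_le_norm (v - gradient u z) (x - z)
    rcases le_total ‖x - z‖ ε with hx | hx
    · have := bregman_nonneg hu.convexOn hd x z
      have := mul_le_mul_of_nonneg_left hx (norm_nonneg (v - gradient u z))
      linarith
    · have := hgrow x hx
      have := mul_le_mul_of_nonneg_right hv.le (norm_nonneg (x - z))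
      have := mul_nonneg hε.le (norm_nonneg (v - gradient u z))
      linarith
  have hup : conjugate u v ≤ inner ℝ v z - u z + ε * ‖v - gradient u z‖ := ciSup_le hle
  have hlow : inner ℝ v z - u z ≤ conjugate u v := le_ciSup ⟨_, Set.forall_mem_range.2 hle⟩ z
  rw [conjugate_gradient hu.convexOn hd, inner_sub_right, real_inner_comm v z,
    real_inner_comm (gradient u z) z, Real.norm_eq_abs, abs_le]
  have := mul_nonneg hε.le (norm_nonneg (v - gradient u z))
  constructor <;> linarith

/-- Bregman duality: `D_{u*}(∇u(y), ∇u(z)) = D_u(z, y)`. -/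
lemma bregman_conjugate {n : ℕ} {u : Vec n → ℝ} (hu : StrictConvexOn ℝ Set.univ u)
    (hd : Differentiable ℝ u) (y z : Vec n) :
    bregman (conjugate u) (gradient u y) (gradient u z) = bregman u z y := by
  rw [bregman, (hasGradientAt_conjugate hu hd z).gradient, conjugate_gradient hu.convexOn hd,
    conjugate_gradient hu.convexOn hd, bregman, inner_sub_right, inner_sub_right,
    real_inner_comm (gradient u y) z, real_inner_comm (gradient u z) z]
  ring

/-! ### Strongly convex extended-real-valued functions -/

lemma ExtStronglyConvex.apply_segment_le {n : ℕ} {μ : ℝ} {F : Vec n → EReal}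
    (hF : ExtStronglyConvex μ F) {x y : Vec n} {a b : ℝ} (hx : F x = a) (hy : F y = b) {t : ℝ}
    (h0 : 0 ≤ t) (h1 : t ≤ 1) :
    F (x + t • (y - x)) ≤
      (((1 - t) * a + t * b - μ / 2 * (t * (1 - t) * ‖y - x‖ ^ 2) : ℝ) : EReal) := by
  have hxm : (x, a + -(μ / 2 * ‖x‖ ^ 2)) ∈
      {q : Vec n × ℝ | F q.1 + ((-(μ / 2 * ‖q.1‖ ^ 2) : ℝ) : EReal) ≤ (q.2 : EReal)} := by
    simp [hx]
  have hym : (y, b + -(μ / 2 * ‖y‖ ^ 2)) ∈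
      {q : Vec n × ℝ | F q.1 + ((-(μ / 2 * ‖q.1‖ ^ 2) : ℝ) : EReal) ≤ (q.2 : EReal)} := by
    simp [hy]
  have h := hF hxm hym (sub_nonneg.2 h1) h0 (by ring)
  have hm : (1 - t) • x + t • y = x + t • (y - x) := by module
  have hnorm : ‖x + t • (y - x)‖ ^ 2 =
      (1 - t) * ‖x‖ ^ 2 + t * ‖y‖ ^ 2 - t * (1 - t) * ‖y - x‖ ^ 2 := by
    simp only [← real_inner_self_eq_norm_sq, inner_add_left, inner_add_right, inner_smul_left,
      inner_smul_right, inner_sub_left, inner_sub_right, conj_trivial, real_inner_comm x y]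
    ring
  simp only [Set.mem_ofPred_eq, Prod.smul_mk, Prod.mk_add_mk, smul_eq_mul, hm, hnorm] at h
  induction hv : F (x + t • (y - x)) using EReal.rec with
  | bot => exact bot_le
  | top =>
    rw [hv, EReal.top_add_coe, top_le_iff] at h
    exact absurd h (EReal.coe_ne_top _)
  | coe v =>
    rw [hv] at h
    norm_cast at h ⊢
    linarith

/-- If `0 ≤ t X + t² Y` for all small `t > 0`, then `0 ≤ X`. -/
lemma nonneg_of_forall_small {X Y : ℝ} (h : ∀ t : ℝ, 0 < t → t ≤ 1 → 0 ≤ t * X + t ^ 2 * Y) :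
    0 ≤ X := by
  by_contra! hX
  have hden : 0 < |Y| - X := by linarith [abs_nonneg Y]
  -- with this `t`, the linear term wins over the quadratic one
  have ht : 0 < -X / (2 * (|Y| - X)) := by
    apply div_pos <;> linarith
  have ht1 : -X / (2 * (|Y| - X)) ≤ 1 := by
    rw [div_le_one (by linarith)]
    linarith [abs_nonneg Y]
  have h1 := h _ ht ht1
  set t := -X / (2 * (|Y| - X)) with htdef
  have h2 : 0 ≤ X + t * Y := by
    by_contra! hneg
    nlinarith
  have h3 : t * (2 * (|Y| - X)) = -X := by
    rw [htdef]; field_simp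
  nlinarith [le_abs_self Y, abs_nonneg Y]

/-- First-order optimality. If `z` minimizes `F + E`, where `F` is strongly convex and `E` is
quadratically close from above to its linearization at `z` with slope `S`, then `-S` is a strong
subgradient of `F` at `z`. -/
lemma ExtStronglyConvex.le_of_mem_argmin_add {n : ℕ} {μ : ℝ} {F : Vec n → EReal}
    (hF : ExtStronglyConvex μ F) {E : Vec n → ℝ} {z w S : Vec n} {A a b : ℝ}
    (hz : z ∈ argmin fun v => F v + (E v : EReal)) (hb : F z = b) (ha : F w = a)
    (hE : ∀ v, E v ≤ E z + inner ℝ S (v - z) + A / 2 * ‖v - z‖ ^ 2) :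
    b + μ / 2 * ‖w - z‖ ^ 2 ≤ a + inner ℝ S (w - z) := by
  have key : 0 ≤ a - b + inner ℝ S (w - z) - μ / 2 * ‖w - z‖ ^ 2 := by
    refine nonneg_of_forall_small (Y := (μ / 2 + A / 2) * ‖w - z‖ ^ 2) fun t ht ht1 => ?_
    have h1 := hF.apply_segment_le hb ha ht.le ht1
    have h2 := hz (z + t • (w - z))
    have h3 := hE (z + t • (w - z))
    rw [add_sub_cancel_left, inner_smul_right, norm_smul, Real.norm_of_nonneg ht.le] at h3
    have h4 := h2.trans (add_le_add_left h1 _)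
    simp only [hb] at h4
    norm_cast at h4
    nlinarith
  linarith

/-- Quadratic growth of a strongly convex function around its minimizer. -/
lemma ExtStronglyConvex.quadratic_growth {n : ℕ} {μ : ℝ} {F : Vec n → EReal}
    (hF : ExtStronglyConvex μ F) {z w : Vec n} {a b : ℝ}
    (hz : z ∈ argmin F) (hb : F z = b) (ha : F w = a) :
    μ / 2 * ‖w - z‖ ^ 2 ≤ a - b := by
  have := hF.le_of_mem_argmin_add (E := fun _ => 0) (S := 0) (A := 0) (z := z)
    (by simpa using hz) hb ha (by simp)
  rw [inner_zero_left] at this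
  linarith

/-- The sum of a finite strongly convex function and an extended-real-valued convex function is
strongly convex. -/
lemma ExtConvex.strongConvexOn_add {n : ℕ} {μ : ℝ} {u : Vec n → ℝ} {g : Vec n → EReal}
    (hg : ExtConvex g) (hbot : ∀ x, g x ≠ ⊥) (hu : StrongConvexOn Set.univ μ u) :
    ExtStronglyConvex μ fun x => (u x : EReal) + g x := by
  have hv := strongConvexOn_iff_convex.1 hu
  rintro ⟨x, r⟩ hx ⟨y, q⟩ hy a b ha hb hab
  have hepi : ∀ (w : Vec n) (t : ℝ),
      (u w : EReal) + g w + ((-(μ / 2 * ‖w‖ ^ 2) : ℝ) : EReal) ≤ (t : EReal) ↔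
        g w ≤ ((t - (u w - μ / 2 * ‖w‖ ^ 2) : ℝ) : EReal) := by
    intro w t
    induction hw : g w using EReal.rec with
    | bot => exact absurd hw (hbot w)
    | top =>
      rw [EReal.coe_add_top, EReal.top_add_coe, top_le_iff, top_le_iff]
      exact iff_of_false (EReal.coe_ne_top _) (EReal.coe_ne_top _)
    | coe v =>
      norm_cast
      constructor <;> intro h <;> linarith
  simp only [Set.mem_ofPred_eq, hepi, Prod.smul_mk, Prod.mk_add_mk, smul_eq_mul] at hx hy ⊢
  have h1 := hg (x := (x, _)) hx (y := (y, _)) hy ha hb hab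
  simp only [Set.mem_ofPred_eq, Prod.smul_mk, Prod.mk_add_mk, smul_eq_mul] at h1
  have h2 := hv.2 (Set.mem_univ x) (Set.mem_univ y) ha hb hab
  simp only [smul_eq_mul] at h2
  refine h1.trans ?_
  norm_cast
  linarith

/-! ### The Lyapunov function in terms of Fenchel-Young gaps -/

/-- For `s` in the range of `∇u`, the dual Bregman distance is the Fenchel-Young gap. -/
lemma bregman_conjugate_eq_gap {n : ℕ} {u : Vec n → ℝ} (hu : StrictConvexOn ℝ Set.univ u)
    (hd : Differentiable ℝ u) {s : Vec n} (hs : s ∈ Set.range (gradient u)) (z : Vec n) :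
    bregman (conjugate u) s (gradient u z) = u z - inner ℝ s z + conjugate u s := by
  obtain ⟨y, rfl⟩ := hs
  rw [bregman_conjugate hu hd, conjugate_gradient hu.convexOn hd, bregman, inner_sub_right]
  ring

lemma bregman_conjugate_nonneg {n : ℕ} {u : Vec n → ℝ} (hu : StrictConvexOn ℝ Set.univ u)
    (hd : Differentiable ℝ u) {s : Vec n} (hs : s ∈ Set.range (gradient u)) (z : Vec n) :
    0 ≤ bregman (conjugate u) s (gradient u z) := by
  obtain ⟨y, rfl⟩ := hs
  rw [bregman_conjugate hu hd]
  exact bregman_nonneg hu.convexOn hd z y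

/-! ### The inner problem and the error bound -/

/-- The standing assumptions: convex `g`, strongly convex average `f`, kernels with Lipschitz
gradients, and stepsizes `γᵢ = α N / Lᵢ` with `α ∈ (0, 1)`. -/
structure Standing {n N : ℕ} (f h : Fin N → Vec n → ℝ) (g : Vec n → EReal) (L : Fin N → ℝ)
    (μf : ℝ) (ℓh : Fin N → ℝ≥0) (α : ℝ) (γ : Fin N → ℝ) : Prop where
  pos : ∀ i, 0 < L i
  basic : BasicAssumption f h g L
  convex : ExtConvex g
  mu_pos : 0 < μf
  strong : StrongConvexOn Set.univ μf (average f)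
  lip : ∀ i, LipschitzWith (ℓh i) (gradient (h i))
  alpha : α ∈ Set.Ioo (0 : ℝ) 1
  step : ∀ i, γ i = α * N / L i

namespace Standing

variable {n N : ℕ} {f h : Fin N → Vec n → ℝ} {g : Vec n → EReal} {L : Fin N → ℝ}
  {μf : ℝ} {ℓh : Fin N → ℝ≥0} {α : ℝ} {γ : Fin N → ℝ}

lemma differentiable_h (H : Standing f h g L μf ℓh α γ) (i : Fin N) : Differentiable ℝ (h i) :=
  (H.basic.legendre i).contDiff.differentiable (by simp)

lemma differentiable_f (H : Standing f h g L μf ℓh α γ) (i : Fin N) :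
    Differentiable ℝ (f i) := by
  intro x
  have hsum : DifferentiableAt ℝ
      (fun y => (L i * h i y + f i y) + (L i * h i y - f i y)) x := by
    have : (fun y => (L i * h i y + f i y) + (L i * h i y - f i y)) = fun y => 2 * L i * h i y := by
      funext y; ring
    rw [this]
    exact (H.differentiable_h i x).const_mul _
  have h1 := differentiableAt_left_of_add (H.basic.relSmooth i).convex_add
    (H.basic.relSmooth i).convex_sub hsum
  have h2 := h1.sub ((H.differentiable_h i x).const_mul (L i))
  exact h2.congr_of_eventuallyEq (Eventually.of_forall fun y => by simp)

lemma differentiable_average (H : Standing f h g L μf ℓh α γ) :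
    Differentiable ℝ (average f) := by
  have := H.differentiable_f
  unfold average
  fun_prop

lemma differentiable_hHat (H : Standing f h g L μf ℓh α γ) (i : Fin N) :
    Differentiable ℝ (hHat f h γ i) := by
  have := H.differentiable_f i
  have := H.differentiable_h i
  unfold hHat
  fun_prop

lemma fderiv_hHat (H : Standing f h g L μf ℓh α γ) (i : Fin N) (x : Vec n) :
    fderiv ℝ (hHat f h γ i) x =
      (1 / γ i) • fderiv ℝ (h i) x - (1 / (N : ℝ)) • fderiv ℝ (f i) x :=
  (((H.differentiable_h i x).hasFDerivAt.const_mul (1 / γ i)).sub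
    ((H.differentiable_f i x).hasFDerivAt.const_mul (1 / (N : ℝ)))).fderiv

lemma gradient_hHat (H : Standing f h g L μf ℓh α γ) (i : Fin N) (x : Vec n) :
    gradient (hHat f h γ i) x =
      (1 / γ i) • gradient (h i) x - (1 / (N : ℝ)) • gradient (f i) x := by
  rw [gradient, H.fderiv_hHat, map_sub, map_smul, map_smul]
  rfl

lemma strictConvexOn_hHat [NeZero N] (H : Standing f h g L μf ℓh α γ) (i : Fin N) :
    StrictConvexOn ℝ Set.univ (hHat f h γ i) := by
  have hN : (0 : ℝ) < N := Nat.cast_pos.2 (NeZero.pos N)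
  have hc := (H.basic.relSmooth i).convex_sub.smul (c := 1 / (N : ℝ)) (by positivity)
  have hα := H.alpha
  have hcoef : 0 < 1 / (N : ℝ) * (1 / α - 1) * L i := by
    have : 1 < 1 / α := by rw [lt_div_iff₀ hα.1]; linarith [hα.2]
    have := H.pos i
    have : 0 < 1 / α - 1 := by linarith
    positivity
  have hs : StrictConvexOn ℝ Set.univ fun x => 1 / (N : ℝ) * (1 / α - 1) * L i * h i x := by
    refine ⟨convex_univ, fun x hx y hy hxy a b ha hb hab => ?_⟩
    have := mul_lt_mul_of_pos_left
      ((H.basic.legendre i).strictConvex.2 hx hy hxy ha hb hab) hcoef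
    simp only [smul_eq_mul] at this ⊢
    linarith
  have : hHat f h γ i = (fun x => (1 / (N : ℝ)) • (L i * h i x - f i x)) +
      fun x => 1 / (N : ℝ) * (1 / α - 1) * L i * h i x := by
    funext x
    have := hα.1.ne'
    have := (H.pos i).ne'
    simp only [hHat, H.step, Pi.add_apply, smul_eq_mul]
    field_simp
    ring
  rw [this]
  exact hc.add_strictConvexOn hs

lemma sum_hHat_eq (x : Vec n) :
    ∑ i, hHat f h γ i x = ∑ i, 1 / γ i * h i x - average f x := by
  simp only [hHat, average, Finset.sum_sub_distrib, Finset.mul_sum]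

/-- Summing over `i` makes the average `f` appear in `∑ᵢ ĥᵢ = ∑ᵢ hᵢ/γᵢ - f`, so that its strong
convexity improves the smoothness modulus. -/
lemma sum_bregman_hHat_le [NeZero N] (H : Standing f h g L μf ℓh α γ) (w z : Vec n) :
    ∑ i, bregman (hHat f h γ i) w z ≤
      ((condNumber L ℓh μf / α - 1) * μf) / 2 * ‖w - z‖ ^ 2 := by
  have hN : (0 : ℝ) < N := Nat.cast_pos.2 (NeZero.pos N)
  have hα := H.alpha.1
  have hμ := H.mu_pos
  have hfd : fderiv ℝ (average f) z = (1 / (N : ℝ)) • ∑ i, fderiv ℝ (f i) z := by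
    have h1 : HasFDerivAt (fun x => ∑ i, f i x) (∑ i, fderiv ℝ (f i) z) z :=
      HasFDerivAt.fun_sum fun i _ => (H.differentiable_f i z).hasFDerivAt
    exact (h1.const_mul (1 / (N : ℝ))).fderiv
  have hsum : ∑ i, bregman (hHat f h γ i) w z =
      ∑ i, 1 / γ i * bregman (h i) w z - bregman (average f) w z := by
    simp only [bregman_eq_fderiv, Finset.sum_sub_distrib, mul_sub, sum_hHat_eq, H.fderiv_hHat, hfd,
      sub_apply, smul_apply, smul_eq_mul, sum_apply, Finset.mul_sum]
    ring
  have h1 : ∑ i, 1 / γ i * bregman (h i) w z ≤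
      ∑ i, 1 / γ i * ((ℓh i : ℝ) / 2 * ‖w - z‖ ^ 2) := by
    refine Finset.sum_le_sum fun i _ => mul_le_mul_of_nonneg_left
      (bregman_le_of_lipschitz (H.differentiable_h i) (H.lip i) w z) ?_
    have := H.pos i
    rw [H.step]
    positivity
  have h2 := le_bregman_of_strongConvexOn H.strong H.differentiable_average w z
  have h3 : ∑ i, 1 / γ i * ((ℓh i : ℝ) / 2 * ‖w - z‖ ^ 2) =
      (condNumber L ℓh μf / α * μf) / 2 * ‖w - z‖ ^ 2 := by
    simp only [condNumber, H.step, Finset.mul_sum, Finset.sum_mul, Finset.sum_div]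
    refine Finset.sum_congr rfl fun i _ => ?_
    have := (H.pos i).ne'
    field_simp
  rw [hsum]
  linarith

lemma condNumber_nonneg (H : Standing f h g L μf ℓh α γ) : 0 ≤ condNumber L ℓh μf := by
  have := H.mu_pos
  have : 0 ≤ ∑ i, L i * (ℓh i : ℝ) :=
    Finset.sum_nonneg fun i _ => mul_nonneg (H.pos i).le (ℓh i).2
  unfold condNumber
  positivity

/-- Outside dimension zero, `∑ᵢ ĥᵢ` is strictly convex, so that its smoothness modulus is
positive. -/
lemma alpha_lt_condNumber [NeZero N] [Nontrivial (Vec n)] (H : Standing f h g L μf ℓh α γ) :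
    α < condNumber L ℓh μf := by
  obtain ⟨w, z, hwz⟩ := exists_pair_ne (Vec n)
  have h1 : 0 < ∑ i, bregman (hHat f h γ i) w z :=
    Finset.sum_pos (fun i _ => bregman_pos (H.strictConvexOn_hHat i) (H.differentiable_hHat i) hwz)
      Finset.univ_nonempty
  have h2 := h1.trans_le (H.sum_bregman_hHat_le w z)
  have hα := H.alpha.1
  by_contra! hle
  have h3 : condNumber L ℓh μf / α - 1 ≤ 0 := by
    rw [sub_nonpos, div_le_one hα]
    exact hle
  have h4 := mul_nonpos_of_nonpos_of_nonneg h3 H.mu_pos.le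
  have := mul_nonneg (neg_nonneg.2 h4) (sq_nonneg ‖w - z‖)
  linarith

lemma cost_stronglyConvex (H : Standing f h g L μf ℓh α γ) :
    ExtStronglyConvex μf (cost f g) :=
  H.convex.strongConvexOn_add H.basic.proper.1 H.strong

lemma cost_ne_bot (H : Standing f h g L μf ℓh α γ) (x : Vec n) : cost f g x ≠ ⊥ := by
  simp [cost, EReal.add_eq_bot_iff, H.basic.proper.1 x]

lemma exists_cost_ne_top (H : Standing f h g L μf ℓh α γ) : ∃ x, cost f g x ≠ ⊤ := by
  obtain ⟨x, hx⟩ := H.basic.proper.2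
  refine ⟨x, ?_⟩
  lift g x to ℝ using ⟨hx, H.basic.proper.1 x⟩ with r hr
  rw [cost, ← hr]
  exact EReal.coe_ne_top (average f x + r)

lemma coe_toReal_cost (H : Standing f h g L μf ℓh α γ) {x : Vec n} (hx : cost f g x ≠ ⊤) :
    cost f g x = ((cost f g x).toReal : EReal) :=
  (EReal.coe_toReal hx (H.cost_ne_bot x)).symm

lemma cost_ne_top_of_mem_argmin (H : Standing f h g L μf ℓh α γ) {x : Vec n}
    (hx : x ∈ argmin (cost f g)) : cost f g x ≠ ⊤ := by
  obtain ⟨y, hy⟩ := H.exists_cost_ne_top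
  exact ne_top_of_le_ne_top hy (hx y)

/-- The inner problem minimizes `φ + ∑ᵢ ĥᵢ - ⟨s, ·⟩`. -/
lemma innerProx_eq (s : Vec n) :
    innerProx h g γ s = argmin fun w =>
      cost f g w + ((∑ i, hHat f h γ i w - inner ℝ s w : ℝ) : EReal) := by
  unfold innerProx
  congr 1
  funext w
  rw [sum_hHat_eq, cost, add_comm ((average f w : ℝ) : EReal), add_assoc, ← EReal.coe_add]
  congr 2
  ring

lemma cost_ne_top_of_mem_innerProx (H : Standing f h g L μf ℓh α γ) {s z : Vec n}
    (hz : z ∈ innerProx h g γ s) : cost f g z ≠ ⊤ := by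
  obtain ⟨y, hy⟩ := H.exists_cost_ne_top
  rw [innerProx_eq (f := f)] at hz
  have := hz y
  intro htop
  simp only [htop, EReal.top_add_coe, top_le_iff] at this
  rw [H.coe_toReal_cost hy, ← EReal.coe_add] at this
  exact EReal.coe_ne_top _ this

lemma innerProx_le (H : Standing f h g L μf ℓh α γ) {s z w : Vec n}
    (hz : z ∈ innerProx h g γ s) (hw : cost f g w ≠ ⊤) :
    (cost f g z).toReal + (∑ i, hHat f h γ i z - inner ℝ s z) ≤
      (cost f g w).toReal + (∑ i, hHat f h γ i w - inner ℝ s w) := by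
  have hzt := H.cost_ne_top_of_mem_innerProx hz
  rw [innerProx_eq (f := f)] at hz
  have : cost f g z + ((∑ i, hHat f h γ i z - inner ℝ s z : ℝ) : EReal) ≤
    cost f g w + ((∑ i, hHat f h γ i w - inner ℝ s w : ℝ) : EReal) := hz w
  rw [H.coe_toReal_cost hw, H.coe_toReal_cost hzt] at this
  exact_mod_cast this

/-- The objective of the inner problem, expanded around `z`. -/
lemma sum_hHat_expand (s w z : Vec n) :
    ∑ i, hHat f h γ i w - inner ℝ s w = (∑ i, hHat f h γ i z - inner ℝ s z) +
      inner ℝ (∑ i, gradient (hHat f h γ i) z - s) (w - z) +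
        ∑ i, bregman (hHat f h γ i) w z := by
  simp only [bregman, Finset.sum_sub_distrib, inner_sub_left, inner_sub_right, sum_inner]
  ring

lemma innerProx_optimality [NeZero N] (H : Standing f h g L μf ℓh α γ) {s z w : Vec n}
    (hz : z ∈ innerProx h g γ s) (hw : cost f g w ≠ ⊤) :
    (cost f g z).toReal + μf / 2 * ‖w - z‖ ^ 2 ≤
      (cost f g w).toReal + inner ℝ (∑ i, gradient (hHat f h γ i) z - s) (w - z) := by
  refine H.cost_stronglyConvex.le_of_mem_argmin_add
    (E := fun v => ∑ i, hHat f h γ i v - inner ℝ s v) (by rwa [innerProx_eq (f := f)] at hz)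
    (H.coe_toReal_cost (H.cost_ne_top_of_mem_innerProx hz)) (H.coe_toReal_cost hw)
    (A := (condNumber L ℓh μf / α - 1) * μf) fun v => ?_
  have := H.sum_bregman_hHat_le v z
  have := sum_hHat_expand (f := f) (h := h) (γ := γ) s v z
  linarith

lemma innerProx_unique [NeZero N] (H : Standing f h g L μf ℓh α γ) {s z w : Vec n}
    (hz : z ∈ innerProx h g γ s) (hw : w ∈ innerProx h g γ s) : w = z := by
  have hzt := H.cost_ne_top_of_mem_innerProx hz
  have hwt := H.cost_ne_top_of_mem_innerProx hw
  have h1 := H.innerProx_optimality hz hwt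
  have h2 := sum_hHat_expand (f := f) (h := h) (γ := γ) s w z
  have h3 : 0 ≤ ∑ i, bregman (hHat f h γ i) w z := Finset.sum_nonneg fun i _ =>
    bregman_nonneg (H.strictConvexOn_hHat i).convexOn (H.differentiable_hHat i) w z
  have h4 := H.innerProx_le hw hzt
  have h5 : ‖w - z‖ ^ 2 ≤ 0 := by
    by_contra! hpos
    have := mul_pos (half_pos H.mu_pos) hpos
    linarith
  have h6 : ‖w - z‖ = 0 := by
    have := sq_nonneg ‖w - z‖
    exact pow_eq_zero_iff (two_ne_zero) |>.1 (le_antisymm h5 this)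
  exact sub_eq_zero.1 (norm_eq_zero.1 h6)

/-- The real value of the Lyapunov function at a point of the domain. -/
lemma toReal_lyapunov (H : Standing f h g L μf ℓh α γ) {z : Vec n} (hz : cost f g z ≠ ⊤)
    (s : Fin N → Vec n) :
    (lyapunov f h g γ z s).toReal = (cost f g z).toReal +
      ∑ i, bregman (conjugate (hHat f h γ i)) (s i) (gradient (hHat f h γ i) z) := by
  rw [lyapunov, H.coe_toReal_cost hz, ← EReal.coe_add, EReal.toReal_coe, EReal.toReal_coe]

lemma sum_gap_eq [NeZero N] (H : Standing f h g L μf ℓh α γ) {s : Fin N → Vec n}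
    (hs : ∀ i, s i ∈ Set.range (gradient (hHat f h γ i))) (w : Vec n) :
    ∑ i, bregman (conjugate (hHat f h γ i)) (s i) (gradient (hHat f h γ i) w) =
      (∑ i, hHat f h γ i w - inner ℝ (∑ i, s i) w) +
        ∑ i, conjugate (hHat f h γ i) (s i) := by
  simp only [bregman_conjugate_eq_gap (H.strictConvexOn_hHat _) (H.differentiable_hHat _) (hs _),
    Finset.sum_add_distrib, Finset.sum_sub_distrib, sum_inner]

lemma gap_nonneg [NeZero N] (H : Standing f h g L μf ℓh α γ) {i : Fin N} {s : Vec n}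
    (hs : s ∈ Set.range (gradient (hHat f h γ i))) (w : Vec n) :
    0 ≤ bregman (conjugate (hHat f h γ i)) s (gradient (hHat f h γ i) w) :=
  bregman_conjugate_nonneg (H.strictConvexOn_hHat i) (H.differentiable_hHat i) hs w

lemma sum_gap_nonneg [NeZero N] (H : Standing f h g L μf ℓh α γ) {s : Fin N → Vec n}
    (hs : ∀ i, s i ∈ Set.range (gradient (hHat f h γ i))) (w : Vec n) :
    0 ≤ ∑ i, bregman (conjugate (hHat f h γ i)) (s i) (gradient (hHat f h γ i) w) :=
  Finset.sum_nonneg fun i _ => H.gap_nonneg (hs i) w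

/-- The Lyapunov function at the solution of the inner problem is the minimal value of
`w ↦ 𝓛(w, s)`. -/
lemma lyapunov_le [NeZero N] (H : Standing f h g L μf ℓh α γ) {s : Fin N → Vec n}
    (hs : ∀ i, s i ∈ Set.range (gradient (hHat f h γ i))) {z w : Vec n}
    (hz : z ∈ innerProx h g γ (∑ i, s i)) (hw : cost f g w ≠ ⊤) :
    (lyapunov f h g γ z s).toReal ≤ (cost f g w).toReal +
      ∑ i, bregman (conjugate (hHat f h γ i)) (s i) (gradient (hHat f h γ i) w) := by
  rw [H.toReal_lyapunov (H.cost_ne_top_of_mem_innerProx hz), H.sum_gap_eq hs, H.sum_gap_eq hs]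
  linarith [H.innerProx_le hz hw]

/-- Error bound: the suboptimality of the Lyapunov function is controlled by the sum of the dual
Bregman distances. With `S = ∑ᵢ (∇ĥᵢ(z) - sᵢ)`, strong convexity bounds `φ(z) - φ⋆` by
`‖S‖²/(2μ)`, and nonnegativity of the summed gaps at the gradient step `z - S/A` bounds `‖S‖²` by
`2A` times the sum of the gaps, `A` being the smoothness modulus of `∑ᵢ ĥᵢ`. -/
lemma lyapunov_sub_le [NeZero N] (H : Standing f h g L μf ℓh α γ) {s : Fin N → Vec n}
    (hs : ∀ i, s i ∈ Set.range (gradient (hHat f h γ i))) {z x : Vec n}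
    (hz : z ∈ innerProx h g γ (∑ i, s i)) (hx : cost f g x ≠ ⊤) :
    α * ((lyapunov f h g γ z s).toReal - (cost f g x).toReal) ≤ condNumber L ℓh μf *
      ∑ i, bregman (conjugate (hHat f h γ i)) (s i) (gradient (hHat f h γ i) z) := by
  have hα := H.alpha.1
  have hμ := H.mu_pos
  rw [H.toReal_lyapunov (H.cost_ne_top_of_mem_innerProx hz)]
  rcases subsingleton_or_nontrivial (Vec n) with hsub | hnt
  · have hzero : ∑ i, bregman (conjugate (hHat f h γ i)) (s i) (gradient (hHat f h γ i) z) = 0 :=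
      Finset.sum_eq_zero fun i _ => by
        rw [Subsingleton.elim (s i) (gradient (hHat f h γ i) z), bregman_self]
    rw [hzero, Subsingleton.elim z x]
    simp
  · have hκ := H.alpha_lt_condNumber
    set G := ∑ i, bregman (conjugate (hHat f h γ i)) (s i) (gradient (hHat f h γ i) z) with hG
    set A := (condNumber L ℓh μf / α - 1) * μf with hA
    have hApos : 0 < A := mul_pos (sub_pos.2 ((one_lt_div hα).2 hκ)) hμ
    set S := ∑ i, gradient (hHat f h γ i) z - ∑ i, s i with hS
    have hgrad : ‖S‖ ^ 2 ≤ 2 * A * G := by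
      have h1 := H.sum_gap_nonneg hs (z - A⁻¹ • S)
      have h2 := H.sum_bregman_hHat_le (z - A⁻¹ • S) z
      rw [H.sum_gap_eq hs, sum_hHat_expand _ _ z] at h1
      rw [H.sum_gap_eq hs] at hG
      rw [← hS, sub_sub_cancel_left, inner_neg_right, inner_smul_right,
        real_inner_self_eq_norm_sq] at h1
      rw [sub_sub_cancel_left, norm_neg, norm_smul, Real.norm_of_nonneg (by positivity),
        ← hA] at h2
      have h3 : A / 2 * (A⁻¹ * ‖S‖) ^ 2 = A⁻¹ * ‖S‖ ^ 2 / 2 := by field_simp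
      have h4 : A⁻¹ * ‖S‖ ^ 2 ≤ 2 * G := by linarith
      rw [inv_mul_le_iff₀ hApos] at h4
      linarith
    have hopt := H.innerProx_optimality hz hx
    rw [← hS] at hopt
    have hcs := real_inner_le_norm S (x - z)
    have hsub : μf * ((cost f g z).toReal - (cost f g x).toReal) ≤ A * G := by
      have h5 : μf * ((cost f g z).toReal - (cost f g x).toReal) ≤
          μf * (‖S‖ * ‖x - z‖ - μf / 2 * ‖x - z‖ ^ 2) :=
        mul_le_mul_of_nonneg_left (by linarith) hμ.le
      nlinarith [sq_nonneg (‖S‖ - μf * ‖x - z‖)]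
    have h6 : (cost f g z).toReal - (cost f g x).toReal ≤ (condNumber L ℓh μf / α - 1) * G := by
      rw [hA, mul_comm _ μf, mul_assoc] at hsub
      exact le_of_mul_le_mul_left hsub hμ
    have h7 := mul_le_mul_of_nonneg_left h6 hα.le
    have h8 : α * ((condNumber L ℓh μf / α - 1) * G) = condNumber L ℓh μf * G - α * G := by
      field_simp
    linarith

end Standing

/-! ### Deterministic properties of the iterates -/

namespace IsBFinito

variable {n N : ℕ} {f h : Fin N → Vec n → ℝ} {g : Vec n → EReal} {L : Fin N → ℝ}
  {μf : ℝ} {ℓh : Fin N → ℝ≥0} {α : ℝ} {γ : Fin N → ℝ} {xinit : Vec n}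
  {I I' : ℕ → Finset (Fin N)} {s s' : ℕ → Fin N → Vec n} {sTilde sTilde' z z' : ℕ → Vec n}

lemma s_mem_range (A : IsBFinito f h g γ xinit I s sTilde z)
    (H : Standing f h g L μf ℓh α γ) (k : ℕ) (i : Fin N) :
    s k i ∈ Set.range (gradient (hHat f h γ i)) := by
  induction k with
  | zero => exact ⟨xinit, by rw [H.gradient_hHat, A.s_zero]⟩
  | succ k ih =>
    rw [A.s_succ]
    split_ifs
    · exact ⟨z k, H.gradient_hHat i (z k)⟩
    · exact ih

lemma sTilde_eq_sum (A : IsBFinito f h g γ xinit I s sTilde z) (k : ℕ) :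
    sTilde k = ∑ i, s k i := by
  induction k with
  | zero => exact A.sTilde_zero
  | succ k ih =>
    have : ∑ i ∈ I (k + 1), (s (k + 1) i - s k i) = ∑ i, (s (k + 1) i - s k i) := by
      refine Finset.sum_subset (Finset.subset_univ _) fun i _ hi => ?_
      rw [A.s_succ, if_neg hi, sub_self]
    rw [A.sTilde_succ, ih, this, Finset.sum_sub_distrib, add_sub_cancel]

lemma mem_innerProx (A : IsBFinito f h g γ xinit I s sTilde z) (k : ℕ) :
    z k ∈ innerProx h g γ (∑ i, s k i) := by
  rw [← A.sTilde_eq_sum]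
  exact A.z_mem k

lemma cost_ne_top (A : IsBFinito f h g γ xinit I s sTilde z)
    (H : Standing f h g L μf ℓh α γ) (k : ℕ) : cost f g (z k) ≠ ⊤ :=
  H.cost_ne_top_of_mem_innerProx (A.z_mem k)

/-- The values at iteration `k` depend only on the index sets that were selected before. -/
lemma congr_history [NeZero N] (A : IsBFinito f h g γ xinit I s sTilde z)
    (A' : IsBFinito f h g γ xinit I' s' sTilde' z') (H : Standing f h g L μf ℓh α γ) (k : ℕ)
    (hI : ∀ j < k, I (j + 1) = I' (j + 1)) : s k = s' k ∧ z k = z' k := by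
  induction k with
  | zero =>
    have hs : s 0 = s' 0 := funext fun i => by rw [A.s_zero, A'.s_zero]
    exact ⟨hs, H.innerProx_unique (A'.mem_innerProx 0) (hs ▸ A.mem_innerProx 0)⟩
  | succ k ih =>
    obtain ⟨hs, hz⟩ := ih fun j hj => hI j (hj.trans k.lt_succ_self)
    have hs1 : s (k + 1) = s' (k + 1) := funext fun i => by
      rw [A.s_succ, A'.s_succ, hI k k.lt_succ_self, hs, hz]
    exact ⟨hs1, H.innerProx_unique (A'.mem_innerProx (k + 1)) (hs1 ▸ A.mem_innerProx (k + 1))⟩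

lemma cost_le_lyapunov [NeZero N] (A : IsBFinito f h g γ xinit I s sTilde z)
    (H : Standing f h g L μf ℓh α γ) (k : ℕ) :
    (cost f g (z k)).toReal ≤ (lyapunov f h g γ (z k) (s k)).toReal := by
  rw [H.toReal_lyapunov (A.cost_ne_top H k)]
  linarith [H.sum_gap_nonneg (A.s_mem_range H k) (z k)]

lemma lyapunov_zero_le [NeZero N] (A : IsBFinito f h g γ xinit I s sTilde z)
    (H : Standing f h g L μf ℓh α γ) (hx : cost f g xinit ≠ ⊤) :
    (lyapunov f h g γ (z 0) (s 0)).toReal ≤ (cost f g xinit).toReal := by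
  have h1 := H.lyapunov_le (A.s_mem_range H 0) (A.mem_innerProx 0) hx
  have h2 : ∑ i, bregman (conjugate (hHat f h γ i)) (s 0 i) (gradient (hHat f h γ i) xinit) = 0 :=
    Finset.sum_eq_zero fun i _ => by rw [A.s_zero, H.gradient_hHat, bregman_self]
  linarith

/-- Sure decrease: updating `sᵢ` removes its dual Bregman distance from the Lyapunov function. -/
lemma lyapunov_succ_le [NeZero N] (A : IsBFinito f h g γ xinit I s sTilde z)
    (H : Standing f h g L μf ℓh α γ) (k : ℕ) :
    (lyapunov f h g γ (z (k + 1)) (s (k + 1))).toReal ≤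
      (lyapunov f h g γ (z k) (s k)).toReal - ∑ i, if i ∈ I (k + 1) then
        bregman (conjugate (hHat f h γ i)) (s k i) (gradient (hHat f h γ i) (z k)) else 0 := by
  have h1 := H.lyapunov_le (A.s_mem_range H (k + 1)) (A.mem_innerProx (k + 1)) (A.cost_ne_top H k)
  rw [H.toReal_lyapunov (A.cost_ne_top H k), add_sub_assoc, ← Finset.sum_sub_distrib]
  refine h1.trans_eq ?_
  congr 1
  refine Finset.sum_congr rfl fun i _ => ?_
  rw [A.s_succ]
  split_ifs
  · rw [← H.gradient_hHat, bregman_self, sub_self]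
  · rw [sub_zero]

end IsBFinito

/-! ### Random sampling -/

/-- A real function of a measurable variable with finitely many values is measurable. -/
lemma stronglyMeasurable_of_factorsThrough {Ω β : Type*} {m : MeasurableSpace Ω}
    [MeasurableSpace β] [Finite β] [MeasurableSingletonClass β] {Y : Ω → β}
    (hY : Measurable Y) {X : Ω → ℝ} (hX : X.FactorsThrough Y) : StronglyMeasurable X := by
  obtain ⟨e, rfl⟩ := (Function.factorsThrough_iff X).1 hX
  exact ((measurable_of_finite e).comp hY).stronglyMeasurable

/-- A real function of a measurable variable with finitely many values is integrable. -/
lemma integrable_of_factorsThrough {Ω β : Type*} {m : MeasurableSpace Ω} {P : Measure Ω}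
    [IsFiniteMeasure P] [MeasurableSpace β] [Finite β] [MeasurableSingletonClass β] {Y : Ω → β}
    (hY : Measurable Y) {X : Ω → ℝ} (hX : X.FactorsThrough Y) : Integrable X P := by
  have hmeas := (stronglyMeasurable_of_factorsThrough hY hX).aestronglyMeasurable (μ := P)
  obtain ⟨e, rfl⟩ := (Function.factorsThrough_iff X).1 hX
  obtain ⟨C, hC⟩ := (Set.finite_range fun b => ‖e b‖).bddAbove
  exact Integrable.of_bound hmeas C (Eventually.of_forall fun ω => hC ⟨Y ω, rfl⟩)

/-- The record of the first `k` selected index sets. -/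
def history {N : ℕ} {Ω : Type*} (I : ℕ → Ω → Finset (Fin N)) (k : ℕ) (ω : Ω) :
    Fin k → Fin N → Prop :=
  fun j i => i ∈ I (j + 1) ω

lemma history_eq_iff {N : ℕ} {Ω : Type*} {I : ℕ → Ω → Finset (Fin N)} {k : ℕ} {ω ω' : Ω} :
    history I k ω = history I k ω' ↔ ∀ j < k, I (j + 1) ω = I (j + 1) ω' := by
  constructor
  · intro h j hj
    ext i
    exact iff_of_eq (congrFun (congrFun h ⟨j, hj⟩) i)
  · intro h
    funext j i
    simp only [history, h j j.2]

namespace IsRandomizedSampling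

variable {N : ℕ} {Ω : Type*} {mΩ : MeasurableSpace Ω} {P : Measure Ω} {ℱ : Filtration ℕ mΩ}
  {p : Fin N → ℝ} {I : ℕ → Ω → Finset (Fin N)}

lemma measurable_history (hI : IsRandomizedSampling P ℱ p I) (k : ℕ) :
    Measurable[ℱ k] (history I k) := by
  refine @measurable_pi_lambda _ _ _ (ℱ k) _ _ fun j =>
    @measurable_pi_lambda _ _ _ (ℱ k) _ _ fun i => ?_
  exact (@measurableSet_setOfPred _ (ℱ k) _).1
    (ℱ.mono (Nat.succ_le_of_lt j.2) _ (hI.measurableSet j i))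

lemma prob_le_one [IsProbabilityMeasure P] (hI : IsRandomizedSampling P ℱ p I) (i : Fin N) :
    p i ≤ 1 := by
  have hm : MeasurableSet {ω | i ∈ I (0 + 1) ω} := ℱ.le _ _ (hI.measurableSet 0 i)
  have h1 := integral_congr_ae (hI.condProb 0 i)
  rw [integral_condExp (ℱ.le 0), integral_indicator_const _ hm] at h1
  simp only [integral_const, probReal_univ, smul_eq_mul, mul_one, one_mul] at h1
  rw [← h1]
  exact measureReal_le_one

/-- Conditional expectation of a sum over the selected indices. -/
lemma condExp_sum_selected [IsFiniteMeasure P] (hI : IsRandomizedSampling P ℱ p I) (k : ℕ)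
    {Y : Fin N → Ω → ℝ} (hY : ∀ i, StronglyMeasurable[ℱ k] (Y i))
    (hint : ∀ i, Integrable (Y i) P) :
    Integrable (fun ω => ∑ i, if i ∈ I (k + 1) ω then Y i ω else 0) P ∧
      P[fun ω => ∑ i, if i ∈ I (k + 1) ω then Y i ω else 0 | ℱ k] =ᵐ[P]
        fun ω => ∑ i, p i * Y i ω := by
  have hm : ∀ i, MeasurableSet {ω | i ∈ I (k + 1) ω} := fun i => ℱ.le _ _ (hI.measurableSet k i)
  have heq : (fun ω => ∑ i, if i ∈ I (k + 1) ω then Y i ω else 0) =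
      ∑ i, Y i * {ω | i ∈ I (k + 1) ω}.indicator (fun _ => (1 : ℝ)) := by
    funext ω
    simp [Set.indicator_apply]
  have hind : ∀ i, Integrable ({ω | i ∈ I (k + 1) ω}.indicator (fun _ => (1 : ℝ))) P := fun i =>
    (integrable_const 1).indicator (hm i)
  have hmul : ∀ i, Integrable (Y i * {ω | i ∈ I (k + 1) ω}.indicator (fun _ => (1 : ℝ))) P := by
    intro i
    have : Y i * {ω | i ∈ I (k + 1) ω}.indicator (fun _ => (1 : ℝ)) =
        {ω | i ∈ I (k + 1) ω}.indicator (Y i) := by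
      funext ω
      simp [Set.indicator_apply]
    rw [this]
    exact (hint i).indicator (hm i)
  rw [heq]
  refine ⟨integrable_finsetSum' _ fun i _ => hmul i, ?_⟩
  refine (condExp_finsetSum (fun i _ => hmul i) (ℱ k)).trans ?_
  have hall : ∀ᵐ ω ∂P, ∀ i,
      (P[Y i * {ω | i ∈ I (k + 1) ω}.indicator (fun _ => (1 : ℝ)) | ℱ k]) ω = p i * Y i ω := by
    rw [ae_all_iff]
    intro i
    filter_upwards [condExp_mul_of_stronglyMeasurable_left (hY i) (hmul i) (hind i),
      hI.condProb k i] with ω h1 h2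
    rw [h1, Pi.mul_apply, h2, mul_comm]
  filter_upwards [hall] with ω hω
  rw [Finset.sum_apply]
  exact Finset.sum_congr rfl fun i _ => hω i

end IsRandomizedSampling

lemma minProb_le {N : ℕ} [NeZero N] (p : Fin N → ℝ) (i : Fin N) : minProb p ≤ p i :=
  Finset.inf'_le _ (Finset.mem_univ i)

lemma minProb_pos {N : ℕ} [NeZero N] {p : Fin N → ℝ} (hp : ∀ i, 0 < p i) : 0 < minProb p :=
  (Finset.lt_inf'_iff _).2 fun i _ => hp i

end BFinito

/-! ### Linear convergence -/

theorem mainTheorem3 {n N : ℕ} [NeZero N]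
    (f h : Fin N → BFinito.Vec n → ℝ) (g : BFinito.Vec n → EReal)
    (L : Fin N → ℝ) (hL : ∀ i, 0 < L i)
    (hbasic : BFinito.BasicAssumption f h g L)
    (hg : BFinito.ExtConvex g)
    (μf : ℝ) (hμf : 0 < μf)
    (hf : StrongConvexOn Set.univ μf (BFinito.average f))
    (ℓh : Fin N → ℝ≥0) (hlip : ∀ i, LipschitzWith (ℓh i) (gradient (h i)))
    (α : ℝ) (hα : α ∈ Set.Ioo (0 : ℝ) 1)
    (γ : Fin N → ℝ) (hγ : ∀ i, γ i = α * N / L i)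
    {Ω : Type*} {mΩ : MeasurableSpace Ω} (P : Measure Ω) [IsProbabilityMeasure P]
    (ℱ : Filtration ℕ mΩ) (p : Fin N → ℝ) (I : ℕ → Ω → Finset (Fin N))
    (hI : BFinito.IsRandomizedSampling P ℱ p I)
    (xinit : BFinito.Vec n)
    (s : ℕ → Ω → Fin N → BFinito.Vec n) (sTilde z : ℕ → Ω → BFinito.Vec n)
    (halg : ∀ ω, BFinito.IsBFinito f h g γ xinit (fun k => I k ω)
      (fun k => s k ω) (fun k => sTilde k ω) (fun k => z k ω))
    (xstar : BFinito.Vec n) (hxstar : xstar ∈ BFinito.argmin (BFinito.cost f g))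
    (φstar : ℝ) (hφstar : φstar = (BFinito.cost f g xstar).toReal)
    (c : ℝ) (hc : c = α * BFinito.minProb p / BFinito.condNumber L ℓh μf) :
    -- the objects in the bounds are well defined
    BFinito.cost f g xstar = (φstar : EReal) ∧
    (∀ k ω, BFinito.cost f g (z k ω) ≠ ⊤ ∧ BFinito.cost f g (z k ω) ≠ ⊥) ∧
    (∀ k, Integrable (fun ω => (BFinito.lyapunov f h g γ (z k ω) (s k ω)).toReal) P ∧
      Integrable (fun ω => (BFinito.cost f g (z k ω)).toReal) P ∧
      Integrable (fun ω => ‖z k ω - xstar‖ ^ 2) P) ∧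
    BFinito.ExtStronglyConvex μf (BFinito.cost f g) ∧
    -- Q-linear decrease of the Lyapunov function in conditional expectation
    (∀ k, P[fun ω => (BFinito.lyapunov f h g γ (z (k + 1) ω) (s (k + 1) ω)).toReal - φstar | ℱ k]
      ≤ᵐ[P] fun ω =>
        (1 - c) * ((BFinito.lyapunov f h g γ (z k ω) (s k ω)).toReal - φstar)) ∧
    -- R-linear decrease of the distance to the solution and of the cost in expectation
    (∀ μφ : ℝ, 0 < μφ → BFinito.ExtStronglyConvex μφ (BFinito.cost f g) → ∀ k,
      ∫ ω, μφ / 2 * ‖z k ω - xstar‖ ^ 2 ∂P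
        ≤ ∫ ω, ((BFinito.cost f g (z k ω)).toReal - φstar) ∂P) ∧
    (∀ k, ((∫ ω, ((BFinito.cost f g (z k ω)).toReal - φstar) ∂P : ℝ) : EReal)
      ≤ (((1 - c) ^ k : ℝ) : EReal) * (BFinito.cost f g xinit - (φstar : EReal))) := by
  have H : BFinito.Standing f h g L μf ℓh α γ := ⟨hL, hbasic, hg, hμf, hf, hlip, hα, hγ⟩
  have hstar_top : BFinito.cost f g xstar ≠ ⊤ := H.cost_ne_top_of_mem_argmin hxstar
  have hstar : BFinito.cost f g xstar = (φstar : EReal) := hφstar ▸ H.coe_toReal_cost hstar_top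
  have hfin : ∀ k ω, BFinito.cost f g (z k ω) ≠ ⊤ := fun k ω => (halg ω).cost_ne_top H k
  -- everything at iteration `k` is a function of the first `k` selected sets
  have hfact : ∀ k (F : (Fin N → BFinito.Vec n) → BFinito.Vec n → ℝ),
      (fun ω => F (s k ω) (z k ω)).FactorsThrough (BFinito.history I k) := by
    intro k F ω ω' hωω'
    obtain ⟨h1, h2⟩ := (halg ω).congr_history (halg ω') H k (BFinito.history_eq_iff.1 hωω')
    simp only at h1 h2 ⊢
    rw [h1, h2]
  have hsm : ∀ k (F : (Fin N → BFinito.Vec n) → BFinito.Vec n → ℝ),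
      StronglyMeasurable[ℱ k] fun ω => F (s k ω) (z k ω) := fun k F =>
    BFinito.stronglyMeasurable_of_factorsThrough (hI.measurable_history k) (hfact k F)
  have hint : ∀ k (F : (Fin N → BFinito.Vec n) → BFinito.Vec n → ℝ),
      Integrable (fun ω => F (s k ω) (z k ω)) P := fun k F =>
    BFinito.integrable_of_factorsThrough ((hI.measurable_history k).mono (ℱ.le k) le_rfl)
      (hfact k F)
  have hintL : ∀ k, Integrable
      (fun ω => (BFinito.lyapunov f h g γ (z k ω) (s k ω)).toReal) P := fun k =>
    hint k fun s z => (BFinito.lyapunov f h g γ z s).toReal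
  have hintC : ∀ k, Integrable (fun ω => (BFinito.cost f g (z k ω)).toReal) P := fun k =>
    hint k fun _ z => (BFinito.cost f g z).toReal
  have hintN : ∀ k, Integrable (fun ω => ‖z k ω - xstar‖ ^ 2) P := fun k =>
    hint k fun _ z => ‖z - xstar‖ ^ 2
  have hpmin := BFinito.minProb_pos hI.pos
  have hdec : ∀ k,
      P[fun ω => (BFinito.lyapunov f h g γ (z (k + 1) ω) (s (k + 1) ω)).toReal - φstar | ℱ k]
        ≤ᵐ[P] fun ω =>
          (1 - c) * ((BFinito.lyapunov f h g γ (z k ω) (s k ω)).toReal - φstar) := by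
    intro k
    let X : Ω → ℝ := fun ω => (BFinito.lyapunov f h g γ (z k ω) (s k ω)).toReal - φstar
    let Y : Fin N → Ω → ℝ := fun i ω => BFinito.bregman (BFinito.conjugate (BFinito.hHat f h γ i))
      (s k ω i) (gradient (BFinito.hHat f h γ i) (z k ω))
    have hY : ∀ i, StronglyMeasurable[ℱ k] (Y i) := fun i => hsm k fun s z =>
      BFinito.bregman (BFinito.conjugate (BFinito.hHat f h γ i)) (s i)
        (gradient (BFinito.hHat f h γ i) z)
    have hYint : ∀ i, Integrable (Y i) P := fun i => hint k fun s z =>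
      BFinito.bregman (BFinito.conjugate (BFinito.hHat f h γ i)) (s i)
        (gradient (BFinito.hHat f h γ i) z)
    have hXm : StronglyMeasurable[ℱ k] X := hsm k fun s z =>
      (BFinito.lyapunov f h g γ z s).toReal - φstar
    have hXint : Integrable X P := (hintL k).sub (integrable_const _)
    obtain ⟨hSint, hS⟩ := hI.condExp_sum_selected k hY hYint
    have hmono := condExp_mono (m := ℱ k) ((hintL (k + 1)).sub (integrable_const φstar))
      (hXint.sub hSint) (Eventually.of_forall fun ω => by
        have := (halg ω).lyapunov_succ_le H k
        simp only [Pi.sub_apply, X, Y]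
        linarith)
    have hsub := condExp_sub (m := ℱ k) hXint hSint
    have hXcond : P[X | ℱ k] = X := condExp_of_stronglyMeasurable (ℱ.le k) hXm hXint
    filter_upwards [hmono, hsub, hS] with ω h1 h2 h3
    refine h1.trans ?_
    rw [h2, Pi.sub_apply, h3, hXcond]
    have hYnn : ∀ i, 0 ≤ Y i ω := fun i => H.gap_nonneg ((halg ω).s_mem_range H k i) (z k ω)
    have h4 : BFinito.minProb p * ∑ i, Y i ω ≤ ∑ i, p i * Y i ω := by
      rw [Finset.mul_sum]
      exact Finset.sum_le_sum fun i _ =>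
        mul_le_mul_of_nonneg_right (BFinito.minProb_le p i) (hYnn i)
    have h5 : α * X ω ≤ BFinito.condNumber L ℓh μf * ∑ i, Y i ω := by
      have := H.lyapunov_sub_le ((halg ω).s_mem_range H k) ((halg ω).mem_innerProx k) hstar_top
      rwa [← hφstar] at this
    have h6 : c * X ω ≤ BFinito.minProb p * ∑ i, Y i ω := by
      rcases H.condNumber_nonneg.eq_or_lt with hκ | hκ
      · rw [hc, ← hκ, div_zero, zero_mul]
        exact mul_nonneg hpmin.le (Finset.sum_nonneg fun i _ => hYnn i)
      · rw [hc, div_mul_eq_mul_div, div_le_iff₀ hκ]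
        have := mul_le_mul_of_nonneg_left h5 hpmin.le
        linarith
    have : (1 - c) * X ω = X ω - c * X ω := by ring
    change X ω - _ ≤ (1 - c) * X ω
    linarith
  refine ⟨hstar, fun k ω => ⟨hfin k ω, H.cost_ne_bot _⟩, fun k => ⟨hintL k, hintC k, hintN k⟩,
    H.cost_stronglyConvex, hdec, fun μφ _ hφ k => ?_, fun k => ?_⟩
  · exact integral_mono ((hintN k).const_mul _) ((hintC k).sub (integrable_const _)) fun ω =>
      hφ.quadratic_growth hxstar hstar (H.coe_toReal_cost (hfin k ω))
  · rcases subsingleton_or_nontrivial (BFinito.Vec n) with hsub | hnt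
    · -- in dimension zero all points agree, and `1 - c` may be negative
      have h0 : ∀ x, BFinito.cost f g x = (φstar : EReal) := fun x =>
        Subsingleton.elim xstar x ▸ hstar
      simp [h0, EReal.sub_self]
    · have hκ := H.alpha_lt_condNumber
      have hκpos := hα.1.trans hκ
      have hc1 : 0 < 1 - c := by
        have h1 : c < BFinito.minProb p := by
          rw [hc, div_lt_iff₀ hκpos, mul_comm]
          exact mul_lt_mul_of_pos_left hκ hpmin
        have h2 := (BFinito.minProb_le p 0).trans (hI.prob_le_one 0)
        linarith
      have hpow : 0 < (1 - c) ^ k := pow_pos hc1 k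
      have hintX : ∀ k, Integrable
          (fun ω => (BFinito.lyapunov f h g γ (z k ω) (s k ω)).toReal - φstar) P := fun k =>
        (hintL k).sub (integrable_const _)
      have hrate : ∀ k, ∫ ω, ((BFinito.lyapunov f h g γ (z k ω) (s k ω)).toReal - φstar) ∂P ≤
          (1 - c) ^ k *
            ∫ ω, ((BFinito.lyapunov f h g γ (z 0 ω) (s 0 ω)).toReal - φstar) ∂P := by
        intro k
        induction k with
        | zero => simp
        | succ k ih =>
          have h1 := integral_mono_ae integrable_condExp ((hintX k).const_mul (1 - c)) (hdec k)
          rw [integral_condExp (ℱ.le k), integral_const_mul] at h1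
          refine h1.trans ((mul_le_mul_of_nonneg_left ih hc1.le).trans_eq ?_)
          ring
      by_cases hx : BFinito.cost f g xinit = ⊤
      · rw [hx, EReal.top_sub_coe, EReal.coe_mul_top_of_pos hpow]
        exact le_top
      · rw [H.coe_toReal_cost hx]
        norm_cast
        have h1 : ∫ ω, ((BFinito.cost f g (z k ω)).toReal - φstar) ∂P ≤
            ∫ ω, ((BFinito.lyapunov f h g γ (z k ω) (s k ω)).toReal - φstar) ∂P :=
          integral_mono ((hintC k).sub (integrable_const _)) (hintX k) fun ω =>
            sub_le_sub_right ((halg ω).cost_le_lyapunov H k) _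
        have h2 : ∫ ω, ((BFinito.lyapunov f h g γ (z 0 ω) (s 0 ω)).toReal - φstar) ∂P ≤
            ∫ _, ((BFinito.cost f g xinit).toReal - φstar) ∂P :=
          integral_mono (hintX 0) (integrable_const _) fun ω =>
            sub_le_sub_right ((halg ω).lyapunov_zero_le H hx) _
        rw [integral_const, probReal_univ, one_smul] at h2
        exact h1.trans ((hrate k).trans (mul_le_mul_of_nonneg_left h2 hpow.le))
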